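/- Let $\Bbbk$ be an algebraically closed field and let $\mathcal{C}$ be a fusion category over $\Bbbk$: a $\Bbbk$-linear abelian rigid monoidal category with $\Bbbk$-bilinear tensor product $\otimes$ and finite-dimensional hom spaces, which is semisimple (every object is a finite direct sum of simple objects), has finitely many simple objects up to isomorphism, and has simple unit object $\mathbb{1}$. Let $[\mathcal{C}]$ be its Grothendieck ring, with product $[X]\cdot[Y]=[X\otimes Y]$ and unit $[\mathbb{1}]$. Let $[\mathcal{C}]_{\ge 0}$ be the set of classes $[X]$ of objects $X$ of $\mathcal{C}$, and let $[\mathcal{C}]_{>0}=[\mathcal{C}]_{\ge 0}\setminus\{0\}$. In the free ring $\mathbb{Z}\langle d,d'\rangle$ on two non-commuting variables, the two-coloured quantum numbers $[k]_d,[k]_{d'}$ $(k\in\mathbb{Z})$ are the elements determined by $[0]_d=[0]_{d'}=0$, $[1]_d=[1]_{d'}=1$ and $$d\cdot[k]_{d'}=[k+1]_d+[k-1]_d,\qquad d'\cdot[k]_d=[k+1]_{d'}+[k-1]_{d'}\qquad(k\in\mathbb{Z}).$$ Let $\Pi$ be any object of $\mathcal{C}$, with left dual ${}^*\Pi$ (so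 the evaluation is a morphism ${}^*\Pi\otimes\Pi\to\mathbb{1}$), and specialize $\mathbb{Z}\langle d,d'\rangle\to[\mathcal{C}]$ via $d\mapsto[\Pi]$, $d'\mapsto[{}^*\Pi]$. In what follows $[k]_d$ and $[k]_{d'}$ denote the images in $[\mathcal{C}]$. 1. Suppose there is $k\in\mathbb{Z}\setminus\{0\}$ such that $[k]_d=0$ or $[k]_{d'}=0$. Then there is a smallest positive integer $m$ with $[m]_d=0$ or $[m]_{d'}=0$, and: - for all $j\in\mathbb{Z}$, $[j]_d=0$ if and only if $m\mid j$, if and only if $[j]_{d'}=0$; - for all integers $j$ with $0<j<m$ and all $c\in\mathbb{Z}$, both $[j+cm]_d$ and $[j+cm]_{d'}$ lie in $(-1)^c\cdot[\mathcal{C}]_{>0}$. 2. Otherwise, that is, if $[k]_d\ne 0$ and $[k]_{d'}\ne 0$ for all $k\in\mathbb{Z}\setminus\{0\}$, one has $[k]_d,[k]_{d'}\in[\mathcal{C}]_{>0}$ for all $k\ge 1$. In particular, in both cases $[k]_d,[k]_{d'}\in[\mathcal{C}]_{>0}\cup\{0\}\cup-[\mathcal{C}]_{>0}$ for all $k\in\mathbb{Z}$.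 -/

import Mathlib

universe w v u

open CategoryTheory MonoidalCategory

attribute [local instance] Abelian.hasFiniteBiproducts

/-! ### Fusion categories -/

/-- A `k`-linear abelian category with a bilinear, rigid monoidal structure is a fusion category
if its hom spaces are finite-dimensional, its unit object is simple, it is semisimple (every object
is a finite direct sum of simple objects), and it has finitely many simple objects up to
isomorphism. -/
class IsFusionCategory (k : Type w) [Field k] (C : Type u) [Category.{v} C] [Abelian C]
    [Linear k C] [MonoidalCategory C] [MonoidalPreadditive C] [MonoidalLinear k C]
    [RigidCategory C] : Prop where
  finite_hom : ∀ X Y : C, Module.Finite k (X ⟶ Y)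
  simple_unit : Simple (𝟙_ C)
  semisimple : ∀ X : C, ∃ (n : ℕ) (S : Fin n → C), (∀ i, Simple (S i)) ∧ Nonempty (X ≅ ⨁ S)
  finite_simples : ∃ (n : ℕ) (S : Fin n → C), ∀ X : C, Simple X → ∃ i, Nonempty (X ≅ S i)

/-! ### The Grothendieck ring -/

/-- The elements `[B] - [A] - [D]` of the free abelian group on the objects, one for each short
exact sequence `0 → A → B → D → 0`. -/
def K0.relations (C : Type u) [Category.{v} C] [Abelian C] : Set (FreeAbelianGroup C) :=
  {x | ∃ S : ShortComplex C, S.ShortExact ∧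
    x = FreeAbelianGroup.of S.X₂ - FreeAbelianGroup.of S.X₁ - FreeAbelianGroup.of S.X₃}

/-- The Grothendieck group of an abelian category: the free abelian group on the objects modulo the
relations `[B] = [A] + [D]` for all short exact sequences `0 → A → B → D → 0`. -/
def K0 (C : Type u) [Category.{v} C] [Abelian C] : Type u :=
  FreeAbelianGroup C ⧸ AddSubgroup.closure (K0.relations C)

namespace K0

section Additive

variable (C : Type u) [Category.{v} C] [Abelian C]

instance : AddCommGroup (K0 C) :=
  inferInstanceAs (AddCommGroup (FreeAbelianGroup C ⧸ AddSubgroup.closure (K0.relations C)))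

variable {C}

/-- The class `[X]` of an object. -/
def mk (X : C) : K0 C :=
  QuotientAddGroup.mk' (AddSubgroup.closure (K0.relations C)) (FreeAbelianGroup.of X)

theorem mk_shortExact {S : ShortComplex C} (hS : S.ShortExact) :
    mk S.X₂ = mk S.X₁ + mk S.X₃ := by
  have h : QuotientAddGroup.mk' (AddSubgroup.closure (K0.relations C))
      (FreeAbelianGroup.of S.X₂ - FreeAbelianGroup.of S.X₁ - FreeAbelianGroup.of S.X₃) = 0 :=
    (QuotientAddGroup.eq_zero_iff _).2 (AddSubgroup.subset_closure ⟨S, hS, rfl⟩)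
  rw [map_sub, map_sub, sub_sub, sub_eq_zero] at h
  exact h

/-- Universal property: an assignment on objects that is additive on short exact sequences induces
a homomorphism on the Grothendieck group. -/
def lift {A : Type*} [AddCommGroup A] (f : C → A)
    (hf : ∀ S : ShortComplex C, S.ShortExact → f S.X₂ = f S.X₁ + f S.X₃) : K0 C →+ A :=
  QuotientAddGroup.lift (AddSubgroup.closure (K0.relations C)) (FreeAbelianGroup.lift f) (by
    rw [AddSubgroup.closure_le]
    rintro _ ⟨S, hS, rfl⟩
    simp [hf S hS])

@[simp]
theorem lift_mk {A : Type*} [AddCommGroup A] (f : C → A)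
    (hf : ∀ S : ShortComplex C, S.ShortExact → f S.X₂ = f S.X₁ + f S.X₃) (X : C) :
    lift f hf (mk X) = f X := by
  change FreeAbelianGroup.lift f (FreeAbelianGroup.of X) = f X
  simp

theorem hom_ext {A : Type*} [AddCommGroup A] {f g : K0 C →+ A}
    (h : ∀ X : C, f (mk X) = g (mk X)) : f = g := by
  have h' : f.comp (QuotientAddGroup.mk' (AddSubgroup.closure (K0.relations C))) =
      g.comp (QuotientAddGroup.mk' (AddSubgroup.closure (K0.relations C))) :=
    FreeAbelianGroup.lift_ext _ _ h
  ext x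
  obtain ⟨y, rfl⟩ := QuotientAddGroup.mk'_surjective _ x
  exact DFunLike.congr_fun h' y

theorem mk_eq_zero {Z : C} (hZ : Limits.IsZero Z) : mk Z = 0 := by
  have h : (ShortComplex.mk (0 : Z ⟶ Z) (0 : Z ⟶ Z) (by simp)).ShortExact :=
    { exact := ShortComplex.exact_of_isZero_X₂ _ hZ
      mono_f := ⟨fun _ _ _ => hZ.eq_of_tgt _ _⟩
      epi_g := ⟨fun _ _ _ => hZ.eq_of_src _ _⟩ }
  simpa using mk_shortExact h

theorem mk_iso {X Y : C} (e : X ≅ Y) : mk X = mk Y := by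
  obtain ⟨Z, hZ⟩ := Limits.HasZeroObject.zero (C := C)
  have h : (ShortComplex.mk e.hom (0 : Y ⟶ Z) (by simp)).ShortExact :=
    { exact := (ShortComplex.exact_iff_epi _ rfl).2 inferInstance
      mono_f := inferInstance
      epi_g := ⟨fun _ _ _ => hZ.eq_of_src _ _⟩ }
  have := mk_shortExact h
  rw [mk_eq_zero hZ, add_zero] at this
  exact this.symm

end Additive

section Multiplicative

instance {C : Type u} [Category.{v} C] [Abelian C] [MonoidalCategory C] : One (K0 C) :=
  ⟨mk (𝟙_ C)⟩

theorem one_def {C : Type u} [Category.{v} C] [Abelian C] [MonoidalCategory C] :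
    (1 : K0 C) = mk (𝟙_ C) := rfl

variable {C : Type u} [Category.{v} C] [Abelian C] [MonoidalCategory C] [MonoidalPreadditive C]
  [RigidCategory C]

theorem shortExact_tensorLeft (X : C) {S : ShortComplex C} (hS : S.ShortExact) :
    (S.map (tensorLeft X)).ShortExact := by
  have : (tensorLeft X).IsLeftAdjoint := (tensorLeftAdjunction (ᘁX) X).isLeftAdjoint
  have : (tensorLeft X).IsRightAdjoint := (tensorLeftAdjunction X (Xᘁ)).isRightAdjoint
  exact hS.map_of_exact _

theorem shortExact_tensorRight (X : C) {S : ShortComplex C} (hS : S.ShortExact) :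
    (S.map (tensorRight X)).ShortExact := by
  have : (tensorRight X).IsLeftAdjoint := (tensorRightAdjunction X (Xᘁ)).isLeftAdjoint
  have : (tensorRight X).IsRightAdjoint := (tensorRightAdjunction (ᘁX) X).isRightAdjoint
  exact hS.map_of_exact _

theorem mk_tensor_shortExact (X : C) {S : ShortComplex C} (hS : S.ShortExact) :
    mk (X ⊗ S.X₂) = mk (X ⊗ S.X₁) + mk (X ⊗ S.X₃) :=
  mk_shortExact (shortExact_tensorLeft X hS)

theorem mk_shortExact_tensor (X : C) {S : ShortComplex C} (hS : S.ShortExact) :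
    mk (S.X₂ ⊗ X) = mk (S.X₁ ⊗ X) + mk (S.X₃ ⊗ X) :=
  mk_shortExact (shortExact_tensorRight X hS)

/-- The multiplication `[X] * [Y] = [X ⊗ Y]` as a biadditive map. -/
def mulHom : K0 C →+ K0 C →+ K0 C :=
  lift (fun X => lift (fun Y => mk (X ⊗ Y))
      (fun _ hS => mk_tensor_shortExact X hS))
    (fun _ hS => hom_ext fun Y => by
      rw [AddMonoidHom.add_apply, lift_mk, lift_mk, lift_mk]
      exact mk_shortExact_tensor Y hS)

instance : Mul (K0 C) := ⟨fun x y => mulHom x y⟩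

theorem mul_def (x y : K0 C) : x * y = mulHom x y := rfl

theorem mk_mul_mk (X Y : C) : mk X * mk Y = mk (X ⊗ Y) := by
  rw [mul_def, mulHom, lift_mk, lift_mk]

theorem one_mul' (x : K0 C) : 1 * x = x := by
  have : mulHom (1 : K0 C) = AddMonoidHom.id (K0 C) := hom_ext fun X => by
    rw [AddMonoidHom.id_apply, one_def, ← mul_def, mk_mul_mk]
    exact mk_iso (λ_ X)
  exact DFunLike.congr_fun this x

theorem mul_one' (x : K0 C) : x * 1 = x := by
  have : (mulHom (C := C)).flip 1 = AddMonoidHom.id (K0 C) := hom_ext fun X => by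
    rw [AddMonoidHom.id_apply, AddMonoidHom.flip_apply, one_def, ← mul_def, mk_mul_mk]
    exact mk_iso (ρ_ X)
  exact DFunLike.congr_fun this x

theorem mul_assoc' (x y z : K0 C) : x * y * z = x * (y * z) := by
  have h1 : ∀ (X Y : C) (z : K0 C), mk X * mk Y * z = mk X * (mk Y * z) := fun X Y z => by
    have : mulHom (mk X * mk Y) = (mulHom (mk X)).comp (mulHom (mk Y)) := hom_ext fun Z => by
      simp only [AddMonoidHom.comp_apply, ← mul_def, mk_mul_mk]
      exact mk_iso (α_ X Y Z)
    exact DFunLike.congr_fun this z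
  have h2 : ∀ (X : C) (y z : K0 C), mk X * y * z = mk X * (y * z) := fun X y z => by
    have : (mulHom.flip z).comp (mulHom (mk X)) = (mulHom (mk X)).comp (mulHom.flip z) :=
      hom_ext fun Y => h1 X Y z
    exact DFunLike.congr_fun this y
  have : (mulHom.flip z).comp (mulHom.flip y) = mulHom.flip (y * z) :=
    hom_ext fun X => h2 X y z
  exact DFunLike.congr_fun this x

/-- The Grothendieck ring, with `[X] * [Y] = [X ⊗ Y]` and `1 = [𝟙]`. -/
instance : Ring (K0 C) :=
  { (inferInstance : AddCommGroup (K0 C)), (inferInstance : Mul (K0 C)),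
    (inferInstance : One (K0 C)) with
    left_distrib := fun x y z => map_add (mulHom x) y z
    right_distrib := fun x y z => by
      simp only [mul_def, map_add, AddMonoidHom.add_apply]
    zero_mul := fun x => by simp only [mul_def, map_zero, AddMonoidHom.zero_apply]
    mul_zero := fun x => map_zero (mulHom x)
    mul_assoc := mul_assoc'
    one_mul := one_mul'
    mul_one := mul_one' }

end Multiplicative

/-- The non-negative elements `[C]_{≥ 0}`: the classes of objects. -/
def nonneg (C : Type u) [Category.{v} C] [Abelian C] : Set (K0 C) :=
  Set.range (mk : C → K0 C)

/-- The positive elements `[C]_{> 0}`: the nonzero non-negative elements. -/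
def pos (C : Type u) [Category.{v} C] [Abelian C] : Set (K0 C) :=
  nonneg C \ {0}

/-- The set `(-1)^c • [C]_{> 0}`, for an integer `c`. -/
def signedPos (C : Type u) [Category.{v} C] [Abelian C] (c : ℤ) : Set (K0 C) :=
  {x | ∃ y ∈ pos C, x = (((-1 : ℤˣ) ^ c : ℤˣ) : ℤ) • y}

end K0

/-! ### Non-commutative two-coloured quantum numbers -/

/-- The two formal variables `d` and `d'`. -/
inductive QVar : Type
  | d
  | d'

/-- The involution exchanging `d` and `d'`. -/
def QVar.swap : QVar → QVar
  | .d => .d'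
  | .d' => .d

/-- The quantum numbers `[n]_c` in `ℤ⟨d, d'⟩` with `n` a natural number. -/
noncomputable def quantumNat : ℕ → QVar → FreeAlgebra ℤ QVar
  | 0, _ => 0
  | 1, _ => 1
  | n + 2, c => FreeAlgebra.ι ℤ c * quantumNat (n + 1) c.swap - quantumNat n c

/-- The two-coloured quantum numbers `[k]_c` in `ℤ⟨d, d'⟩` with `k` an integer. They are the
elements determined by `quantum_zero`, `quantum_one` and `quantum_recurse`. -/
noncomputable def quantum : ℤ → QVar → FreeAlgebra ℤ QVar
  | Int.ofNat n, c => quantumNat n c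
  | Int.negSucc n, c => -quantumNat (n + 1) c

theorem quantum_zero (c : QVar) : quantum 0 c = 0 := by
  change quantumNat 0 c = 0
  simp [quantumNat]

theorem quantum_one (c : QVar) : quantum 1 c = 1 := by
  change quantumNat 1 c = 1
  simp [quantumNat]

theorem quantum_neg (k : ℤ) (c : QVar) : quantum (-k) c = -quantum k c := by
  rcases k with (_ | n) | n
  · change quantumNat 0 c = -quantumNat 0 c
    simp [quantumNat]
  · rfl
  · change quantumNat (n + 1) c = - -quantumNat (n + 1) c
    rw [neg_neg]

theorem quantum_recurse (k : ℤ) (c : QVar) :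
    FreeAlgebra.ι ℤ c * quantum k c.swap = quantum (k + 1) c + quantum (k - 1) c := by
  have key : ∀ n : ℕ, FreeAlgebra.ι ℤ c * quantum ((n : ℤ) + 1) c.swap =
      quantum ((n : ℤ) + 1 + 1) c + quantum ((n : ℤ) + 1 - 1) c := fun n => by
    rw [add_sub_cancel_right]
    change FreeAlgebra.ι ℤ c * quantumNat (n + 1) c.swap = quantumNat (n + 2) c + quantumNat n c
    rw [quantumNat, sub_add_cancel]
  rcases k with (_ | n) | n
  · change FreeAlgebra.ι ℤ c * quantum 0 c.swap = quantum 1 c + quantum (-1) c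
    simp [quantum_zero, quantum_neg]
  · exact key n
  · have h := key n
    have e : Int.negSucc n = -((n : ℤ) + 1) := rfl
    rw [e, show -((n : ℤ) + 1) + 1 = -((n : ℤ) + 1 - 1) by ring,
      show -((n : ℤ) + 1) - 1 = -((n : ℤ) + 1 + 1) by ring]
    simp only [quantum_neg, mul_neg, h]
    abel

section Specialization

variable {C : Type u} [Category.{v} C] [Abelian C] [MonoidalCategory C] [MonoidalPreadditive C]
  [RigidCategory C]

/-- The ring homomorphism `ℤ⟨d, d'⟩ → [C]` with `d ↦ [P]` and `d' ↦ [*P]`, where `*P` is the dual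
of `P` with evaluation `*P ⊗ P ⟶ 𝟙` and coevaluation `𝟙 ⟶ P ⊗ *P`. Mathlib calls this
dual the right dual `Pᘁ`. -/
noncomputable def specialize (P : C) : FreeAlgebra ℤ QVar →ₐ[ℤ] K0 C :=
  FreeAlgebra.lift ℤ (fun c : QVar => match c with
    | .d => K0.mk P
    | .d' => K0.mk (Pᘁ))

/-- The quantum number `[k]_c` interpreted in `[C]`. -/
noncomputable def quantumIn (P : C) (k : ℤ) (c : QVar) : K0 C :=
  specialize P (quantum k c)

end Specialization

/-! The quantum numbers are realised by reflections of indecomposable representations. Treat a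
morphism `g : X ⟶ T Y`, with `T` tensoring by `P` or its dual, as a representation; start from `0 ⟶
T 𝟙`, which is indecomposable because `𝟙` is simple. If `Y ≠ 0`, indecomposability and
semisimplicity make `g` mono (`HasTrivialIdempotents.mono`). Transposing `T Y ⟶ coker g` gives
another indecomposable (`HasTrivialIdempotents.cokernel`), and on classes this is the recursion for
quantum numbers. Hence they are classes of objects up to and including the first zero
(`exists_hasTrivialIdempotents`).

Repeating the step requires adjunctions in both directions, hence that left and right duals of `P`
agree (`nonempty_leftDual_iso_rightDual`). At the first zero, `quantumNat_mul_ι` and the absence of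
zero divisors among objects make the other colour vanish too (`quantumIn_eq_zero_of_swap`). The
recursion is then antisymmetric about `m` as well as about `0`, which determines all remaining
values and signs. -/

open Limits Module

/-! ### Splitting of epimorphisms and monomorphisms -/

section Semisimple

variable {C : Type u} [Category.{v} C] [Abelian C]

theorem projective_biproduct {n : ℕ} (S : Fin n → C) (h : ∀ i, Projective (S i)) :
    Projective (⨁ S) where
  factors {E X} f e _ := by
    refine ⟨biproduct.desc fun i => Projective.factorThru (biproduct.ι S i ≫ f) e, ?_⟩
    ext i
    simp

/-- In an abelian category all of whose objects are finite direct sums of simple objects, every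
object is projective. -/
theorem projective_of_semisimple
    (hss : ∀ X : C, ∃ (n : ℕ) (S : Fin n → C), (∀ i, Simple (S i)) ∧ Nonempty (X ≅ ⨁ S)) (X : C) :
    Projective X := by
  have simple_projective : ∀ S : C, Simple S → Projective S := fun S _ => ⟨fun {E X} f e _ => by
    -- The pullback of `e` along `f` is an epimorphism onto `S`, so it is nonzero on some simple
    -- summand. By Schur's lemma that summand maps isomorphically to `S`; inverting this map
    -- produces the lift.
    obtain ⟨n, T, hT, ⟨i⟩⟩ := hss (pullback f e)
    have hne : i.inv ≫ pullback.fst f e ≠ 0 := fun h0 => by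
      have h1 : pullback.fst f e = 0 := by
        rw [← cancel_epi i.inv, h0, comp_zero]
      have : Epi (pullback.fst f e) := inferInstance
      refine id_nonzero S ?_
      rw [← cancel_epi (pullback.fst f e), h1, zero_comp, zero_comp]
    obtain ⟨j, hj⟩ : ∃ j, biproduct.ι T j ≫ i.inv ≫ pullback.fst f e ≠ 0 := by
      by_contra! h
      exact hne (by ext j; rw [h j, comp_zero])
    have := hT j
    have := isIso_of_hom_simple hj
    refine ⟨inv (biproduct.ι T j ≫ i.inv ≫ pullback.fst f e) ≫ biproduct.ι T j ≫ i.inv ≫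
      pullback.snd f e, ?_⟩
    rw [Category.assoc, IsIso.inv_comp_eq]
    simp [pullback.condition]⟩
  obtain ⟨n, S, hS, ⟨i⟩⟩ := hss X
  exact Projective.of_iso i.symm (projective_biproduct S fun j => simple_projective _ (hS j))

/-- If all objects are projective, then every monomorphism has a retraction. -/
theorem exists_retraction (h : ∀ X : C, Projective X) {X Y : C} (f : X ⟶ Y) [Mono f] :
    ∃ r : Y ⟶ X, f ≫ r = 𝟙 X := by
  have := h (cokernel f)
  have hS : (ShortComplex.mk f (cokernel.π f) (cokernel.condition f)).ShortExact :=
    { exact := ShortComplex.exact_cokernel f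
      mono_f := inferInstance
      epi_g := inferInstance }
  exact ⟨_, (hS.splittingOfProjective).f_r⟩

end Semisimple

/-! ### Detecting zero objects by their classes -/

namespace K0

variable {C : Type u} [Category.{v} C] [Abelian C]

theorem finrank_hom_shortExact (k : Type w) [Field k] [Linear k C]
    [∀ X Y : C, Module.Finite k (X ⟶ Y)] (Z : C) [Projective Z]
    {S : ShortComplex C} (hS : S.ShortExact) :
    finrank k (Z ⟶ S.X₂) = finrank k (Z ⟶ S.X₁) + finrank k (Z ⟶ S.X₃) := by
  have := hS.mono_f
  have := hS.epi_g
  have hf : Function.Injective (Linear.rightComp k Z S.f) := fun a b h => by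
    simpa [cancel_mono] using h
  have hg : Function.Surjective (Linear.rightComp k Z S.g) := fun a =>
    ⟨Projective.factorThru a S.g, by simp⟩
  have hex : LinearMap.ker (Linear.rightComp k Z S.g) = LinearMap.range (Linear.rightComp k Z S.f) := by
    ext a
    simp only [LinearMap.mem_ker, LinearMap.mem_range, Linear.rightComp_apply]
    constructor
    · intro ha
      exact ⟨hS.exact.lift a ha, hS.exact.lift_f a ha⟩
    · rintro ⟨b, rfl⟩
      simp
  have h := LinearMap.finrank_range_add_finrank_ker (Linear.rightComp k Z S.g)
  rw [hex, LinearMap.finrank_range_of_inj hf, LinearMap.range_eq_top.2 hg, finrank_top] at h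
  omega

/-- Since `Z` is projective, `dim Hom(Z, -)` descends to `K0`. Its value at `Z` itself is `dim End
Z`, so a zero class forces the identity of `Z` to vanish. -/
theorem isZero_of_mk_eq_zero (k : Type w) [Field k] [Linear k C]
    [∀ X Y : C, Module.Finite k (X ⟶ Y)] {Z : C} [Projective Z] (h : mk Z = 0) : IsZero Z := by
  have h' := congrArg (lift (fun X => (finrank k (Z ⟶ X) : ℤ))
    fun S hS => by exact_mod_cast finrank_hom_shortExact k Z hS) h
  rw [lift_mk, map_zero, Nat.cast_eq_zero, finrank_zero_iff] at h'
  exact (IsZero.iff_id_eq_zero Z).2 (Subsingleton.elim _ _)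

end K0

/-! ### Hom dimensions and multiplicities -/

section HomDimension

variable (k : Type w) [Field k] {C : Type u} [Category.{v} C] [Abelian C] [Linear k C]

/-- Morphisms between finite direct sums are matrices. -/
noncomputable def homBiproductLinearEquiv {m n : ℕ} (S : Fin m → C) (T : Fin n → C) :
    (⨁ S ⟶ ⨁ T) ≃ₗ[k] ∀ i j, S i ⟶ T j :=
  { biproduct.matrixEquiv with
    map_add' := fun f g => by
      ext i j
      simp [biproduct.matrixEquiv, biproduct.components]
    map_smul' := fun c f => by
      ext i j
      simp [biproduct.matrixEquiv, biproduct.components] }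

theorem finrank_hom_biproduct [∀ X Y : C, Module.Finite k (X ⟶ Y)] {m n : ℕ} (S : Fin m → C)
    (T : Fin n → C) : finrank k (⨁ S ⟶ ⨁ T) = ∑ i, ∑ j, finrank k (S i ⟶ T j) := by
  rw [(homBiproductLinearEquiv k S T).finrank_eq, finrank_pi_fintype]
  exact Finset.sum_congr rfl fun i _ => finrank_pi_fintype k

variable [IsAlgClosed k] [∀ X Y : C, Module.Finite k (X ⟶ Y)]

/-- Over an algebraically closed field, Schur's lemma gives dimension 1 or 0 between simples,
according to whether they are isomorphic; this is symmetric, and bilinearity over direct sums does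
the rest. -/
theorem finrank_hom_comm
    (hss : ∀ X : C, ∃ (n : ℕ) (S : Fin n → C), (∀ i, Simple (S i)) ∧ Nonempty (X ≅ ⨁ S))
    (X Y : C) : finrank k (X ⟶ Y) = finrank k (Y ⟶ X) := by
  classical
  obtain ⟨m, S, hS, ⟨i⟩⟩ := hss X
  obtain ⟨n, T, hT, ⟨j⟩⟩ := hss Y
  rw [(Linear.homCongr k i j).finrank_eq, (Linear.homCongr k j i).finrank_eq,
    finrank_hom_biproduct, finrank_hom_biproduct, Finset.sum_comm]
  refine Finset.sum_congr rfl fun b _ => Finset.sum_congr rfl fun a _ => ?_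
  have := hS a
  have := hT b
  rw [finrank_hom_simple_simple, finrank_hom_simple_simple]
  exact if_congr ⟨fun ⟨e⟩ => ⟨e.symm⟩, fun ⟨e⟩ => ⟨e.symm⟩⟩ rfl rfl

/-- The dimension of `Hom(T, X)` for `T` simple is the multiplicity of `T` in `X`. -/
theorem finrank_hom_simple_biproduct (T : C) [Simple T] {n : ℕ} (S : Fin n → C)
    (hS : ∀ i, Simple (S i)) :
    finrank k (T ⟶ ⨁ S) = Nat.card {i // Nonempty (T ≅ S i)} := by
  classical
  have e : (T ⟶ ⨁ S) ≃ₗ[k] ∀ i, T ⟶ S i :=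
    { toFun := fun f i => f ≫ biproduct.π S i
      invFun := fun f => biproduct.lift f
      left_inv := fun f => by ext; simp
      right_inv := fun f => by ext; simp
      map_add' := fun f g => by ext; simp
      map_smul' := fun c f => by ext; simp }
  rw [e.finrank_eq, finrank_pi_fintype, Nat.card_eq_fintype_card, Fintype.card_subtype,
    Finset.card_filter]
  refine Finset.sum_congr rfl fun i _ => ?_
  have := hS i
  exact finrank_hom_simple_simple k T (S i)

/-- Two objects with the same multiplicities are isomorphic. -/
theorem nonempty_iso_of_finrank_hom_eq
    (hss : ∀ X : C, ∃ (n : ℕ) (S : Fin n → C), (∀ i, Simple (S i)) ∧ Nonempty (X ≅ ⨁ S))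
    {X Y : C}
    (h : ∀ T : C, finrank k (T ⟶ X) = finrank k (T ⟶ Y)) : Nonempty (X ≅ Y) := by
  obtain ⟨m, S, hS, ⟨i⟩⟩ := hss X
  obtain ⟨n, T, hT, ⟨j⟩⟩ := hss Y
  have hcard : ∀ Z : C, Simple Z →
      Nat.card {a // Nonempty (Z ≅ S a)} = Nat.card {b // Nonempty (Z ≅ T b)} := fun Z _ => by
    rw [← finrank_hom_simple_biproduct k Z S hS, ← finrank_hom_simple_biproduct k Z T hT,
      ← (Linear.homCongr k (Iso.refl Z) i).finrank_eq, ← (Linear.homCongr k (Iso.refl Z) j).finrank_eq,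
      h]
  let cls : C → Quotient (isIsomorphicSetoid C) := Quotient.mk _
  have hcls : ∀ Z W : C, cls W = cls Z ↔ Nonempty (Z ≅ W) := fun Z W =>
    Quotient.eq.trans ⟨fun ⟨e⟩ => ⟨e.symm⟩, fun ⟨e⟩ => ⟨e.symm⟩⟩
  -- The summands are matched one isomorphism class at a time. Over a non-simple class both fibres
  -- are empty.
  have hfib : ∀ q, Nonempty ({a // cls (S a) = q} ≃ {b // cls (T b) = q}) := fun q => by
    obtain ⟨Z, rfl⟩ : ∃ Z, cls Z = q := Quotient.exists_rep q
    by_cases hZ : Simple Z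
    · refine Finite.card_eq.1 ?_
      simpa only [hcls] using hcard Z hZ
    · have h1 : IsEmpty {a // cls (S a) = cls Z} := ⟨fun ⟨a, ha⟩ => hZ (by
        obtain ⟨e⟩ := (hcls _ _).1 ha
        have := hS a
        exact Simple.of_iso e)⟩
      have h2 : IsEmpty {b // cls (T b) = cls Z} := ⟨fun ⟨b, hb⟩ => hZ (by
        obtain ⟨e⟩ := (hcls _ _).1 hb
        have := hT b
        exact Simple.of_iso e)⟩
      exact ⟨Equiv.equivOfIsEmpty _ _⟩
  let σ : Fin m ≃ Fin n := Equiv.ofFiberEquiv fun q => (hfib q).some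
  have hσ : ∀ a, Nonempty (T (σ a) ≅ S a) := fun a =>
    (hcls _ _).1 (Equiv.ofFiberEquiv_map (fun q => (hfib q).some) a).symm
  exact ⟨i ≪≫ biproduct.whiskerEquiv σ (fun a => (hσ a).some) ≪≫ j.symm⟩

end HomDimension

/-! ### Duals and products of nonzero objects -/

section Duals

variable {C : Type u} [Category.{v} C] [Abelian C] [MonoidalCategory C] [MonoidalPreadditive C]

theorem isZero_tensor_left {X : C} (h : IsZero X) (Y : C) : IsZero (X ⊗ Y) := by
  rw [IsZero.iff_id_eq_zero] at h ⊢
  rw [← id_whiskerRight, h, MonoidalPreadditive.zero_whiskerRight]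

theorem isZero_tensor_right (X : C) {Y : C} (h : IsZero Y) : IsZero (X ⊗ Y) := by
  rw [IsZero.iff_id_eq_zero] at h ⊢
  rw [← whiskerLeft_id, h, MonoidalPreadditive.whiskerLeft_zero]

/-- A zigzag identity factors the identity of `X`, up to unitors, through the coevaluation. -/
theorem isZero_left_of_coevaluation_eq_zero (X Y : C) [ExactPairing X Y] (h : η_ X Y = 0) :
    IsZero X := by
  rw [IsZero.iff_id_eq_zero]
  have h1 := ExactPairing.evaluation_coevaluation X Y
  rw [h, MonoidalPreadditive.zero_whiskerRight, zero_comp] at h1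
  have h2 := congrArg (fun t => (λ_ X).inv ≫ t ≫ (ρ_ X).hom) h1
  simpa using h2.symm

theorem isZero_right_of_coevaluation_eq_zero (X Y : C) [ExactPairing X Y] (h : η_ X Y = 0) :
    IsZero Y := by
  rw [IsZero.iff_id_eq_zero]
  have h1 := ExactPairing.coevaluation_evaluation X Y
  rw [h, MonoidalPreadditive.whiskerLeft_zero, zero_comp] at h1
  have h2 := congrArg (fun t => (ρ_ Y).inv ≫ t ≫ (λ_ Y).hom) h1
  simpa using h2.symm

theorem isZero_iff_of_exactPairing (X Y : C) [ExactPairing X Y] : IsZero X ↔ IsZero Y :=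
  ⟨fun h => isZero_right_of_coevaluation_eq_zero X Y ((isZero_tensor_left h Y).eq_of_tgt _ _),
    fun h => isZero_left_of_coevaluation_eq_zero X Y ((isZero_tensor_right X h).eq_of_tgt _ _)⟩

/-- The nonzero coevaluation `𝟙 ⟶ ᘁX ⊗ X` is mono because `𝟙` is simple. Tensoring with `Y`
preserves this, so `Y` embeds in `ᘁX ⊗ X ⊗ Y`. -/
theorem isZero_of_isZero_tensor [RigidCategory C] [Simple (𝟙_ C)] {X Y : C} (hX : ¬ IsZero X)
    (h : IsZero (X ⊗ Y)) : IsZero Y := by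
  have hη : η_ (ᘁX) X ≠ 0 := fun h0 => hX (isZero_right_of_coevaluation_eq_zero _ _ h0)
  have := mono_of_nonzero_from_simple hη
  have : (tensorRight Y).IsRightAdjoint := (tensorRightAdjunction (ᘁY) Y).isRightAdjoint
  have : Mono (η_ (ᘁX) X ▷ Y) := inferInstanceAs (Mono ((tensorRight Y).map _))
  have hz : IsZero (((ᘁX) ⊗ X) ⊗ Y) :=
    (isZero_tensor_right (ᘁX) h).of_iso (α_ _ _ _)
  refine IsZero.of_iso ?_ (λ_ Y).symm
  rw [IsZero.iff_id_eq_zero, ← cancel_mono (η_ (ᘁX) X ▷ Y)]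
  exact hz.eq_of_tgt _ _

variable (k : Type w) [Field k] [Linear k C] [MonoidalLinear k C]

/-- The linear form of `tensorLeftHomEquiv`. -/
noncomputable def tensorLeftHomLinearEquiv (X Y Y' Z : C) [ExactPairing Y Y'] :
    (Y' ⊗ X ⟶ Z) ≃ₗ[k] (X ⟶ Y ⊗ Z) :=
  { tensorLeftHomEquiv X Y Y' Z with
    map_add' := fun f g => by simp [tensorLeftHomEquiv]
    map_smul' := fun c f => by simp [tensorLeftHomEquiv] }

/-- In a semisimple rigid category over an algebraically closed field, left and right duals
agree. -/
theorem nonempty_leftDual_iso_rightDual [IsAlgClosed k] [RigidCategory C]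
    [∀ X Y : C, Module.Finite k (X ⟶ Y)]
    (hss : ∀ X : C, ∃ (n : ℕ) (S : Fin n → C), (∀ i, Simple (S i)) ∧ Nonempty (X ≅ ⨁ S))
    (P : C) : Nonempty ((ᘁP : C) ≅ Pᘁ) := by
  refine nonempty_iso_of_finrank_hom_eq k hss fun T => ?_
  -- In dimensions: `Hom(T, ᘁP) = Hom(P ⊗ T, 𝟙) = Hom(𝟙, P ⊗ T) = Hom(Pᘁ, T) = Hom(T, Pᘁ)`,
  -- alternating adjunction with the symmetry `finrank_hom_comm`.
  rw [← (Linear.homCongr k (Iso.refl T) (ρ_ (ᘁP : C))).finrank_eq,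
    ← (tensorLeftHomLinearEquiv k T (ᘁP : C) P (𝟙_ C)).finrank_eq, finrank_hom_comm k hss,
    ← (tensorLeftHomLinearEquiv k (𝟙_ C) P (Pᘁ) T).finrank_eq,
    (Linear.homCongr k (ρ_ (Pᘁ)) (Iso.refl T)).finrank_eq, finrank_hom_comm k hss]

end Duals

/-! ### Indecomposable representations and reflection -/

section Chain

variable {C : Type u} [Category.{v} C] [Abelian C]

theorem idempotent_eq_zero_or_id {X : C} [Simple X] {b : X ⟶ X} (hb : b ≫ b = b) :
    b = 0 ∨ b = 𝟙 X := by
  by_cases h : b = 0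
  · exact Or.inl h
  · have := isIso_of_hom_simple h
    exact Or.inr (by rw [← cancel_epi b, hb, Category.comp_id])

/-- A morphism `g : X ⟶ T Y` has only the trivial idempotent endomorphisms `0` and `1`. -/
def HasTrivialIdempotents {T : C ⥤ C} {X Y : C} (g : X ⟶ T.obj Y) : Prop :=
  ∀ (a : X ⟶ X) (b : Y ⟶ Y), a ≫ a = a → b ≫ b = b → a ≫ g = g ≫ T.map b →
    (a = 0 ∧ b = 0) ∨ (a = 𝟙 X ∧ b = 𝟙 Y)

/-- The kernel of `g` is a direct summand of `X`, so projecting onto it, paired with `0` on `Y`, is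
an idempotent endomorphism of `g`. As `Y` is nonzero, this pair must be `(0, 0)`. -/
theorem HasTrivialIdempotents.mono {T : C ⥤ C} [T.Additive] {X Y : C} {g : X ⟶ T.obj Y}
    (hg : HasTrivialIdempotents g) (hY : ¬ IsZero Y) (hproj : ∀ X : C, Projective X) : Mono g := by
  obtain ⟨r, hr⟩ := exists_retraction hproj (kernel.ι g)
  rcases hg (r ≫ kernel.ι g) 0 (by simp [reassoc_of% hr]) (by simp) (by simp) with h | h
  · refine Preadditive.mono_of_kernel_zero ?_
    rw [← Category.id_comp (kernel.ι g), ← hr, Category.assoc, h.1, comp_zero]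
  · exact absurd ((IsZero.iff_id_eq_zero Y).2 h.2.symm) hY

/-- The reflection step: pass from `g : X ⟶ T Y` to the transpose `Y ⟶ T' (coker g)` of the
projection `T Y ⟶ coker g`. -/
theorem HasTrivialIdempotents.cokernel {T T' : C ⥤ C} [T.Additive] (adj : T ⊣ T') {X Y : C}
    {g : X ⟶ T.obj Y} (hg : HasTrivialIdempotents g) [Mono g] :
    HasTrivialIdempotents (adj.homEquiv Y (Limits.cokernel g) (cokernel.π g)) := by
  intro a b ha hb hab
  have hab' : T.map a ≫ cokernel.π g = cokernel.π g ≫ b := by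
    apply (adj.homEquiv _ _).injective
    rw [adj.homEquiv_naturality_left, adj.homEquiv_naturality_right, hab]
  have hex : (ShortComplex.mk g (cokernel.π g) (cokernel.condition g)).Exact :=
    ShortComplex.exact_cokernel g
  have : Mono (ShortComplex.mk g (cokernel.π g) (cokernel.condition g)).f := ‹Mono g›
  -- By `hab'`, `T.map a` preserves the kernel of the projection, which is `X`. It restricts there
  -- to an idempotent `a₀`, and triviality for `g` then fixes `a`, hence `b`.
  obtain ⟨a₀, h₀⟩ : ∃ a₀ : X ⟶ X, a₀ ≫ g = g ≫ T.map a :=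
    ⟨hex.lift (g ≫ T.map a) (by simp [hab']), hex.lift_f _ _⟩
  have h₀₀ : a₀ ≫ a₀ = a₀ := by
    rw [← cancel_mono g, Category.assoc, h₀, reassoc_of% h₀, ← T.map_comp, ha]
  rcases hg a₀ a h₀₀ ha h₀ with ⟨-, rfl⟩ | ⟨-, rfl⟩
  · refine Or.inl ⟨rfl, ?_⟩
    rw [← cancel_epi (cokernel.π g), ← hab']
    simp
  · refine Or.inr ⟨rfl, ?_⟩
    rw [← cancel_epi (cokernel.π g), ← hab']
    simp

end Chain

/-! ### Formal identities and ambidexterity -/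

theorem QVar.swap_swap (c : QVar) : c.swap.swap = c := by cases c <;> rfl

/-- `[n]_c` is a combination of alternating words starting with `c`, of lengths congruent to `n - 1`
mod 2, with coefficients independent of the colour. Extending on the right or on the left gives the
same alternating words. Only the parity of the exponent `n + 1` matters. -/
theorem quantumNat_mul_ι (n : ℕ) (c : QVar) :
    quantumNat n c * FreeAlgebra.ι ℤ (QVar.swap^[n + 1] c) =
      FreeAlgebra.ι ℤ c * quantumNat n c.swap := by
  induction n using Nat.twoStepInduction generalizing c with
  | zero => simp [quantumNat]
  | one => simp [quantumNat, QVar.swap_swap]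
  | more n h0 h1 =>
    have e : QVar.swap^[n + 2 + 1] c = QVar.swap^[n + 1] c := by
      simp [Function.iterate_succ_apply, QVar.swap_swap]
    have h1' := h1 c.swap
    rw [← Function.iterate_succ_apply, QVar.swap_swap] at h1'
    rw [quantumNat, quantumNat, QVar.swap_swap, sub_mul, mul_assoc, h1', e, h0, mul_sub]

/-- The object specializing a variable. -/
noncomputable def QVar.obj {C : Type u} [Category.{v} C] [MonoidalCategory C] [RigidCategory C]
    (P : C) : QVar → C
  | .d => P
  | .d' => Pᘁ

/-- The ambidextrous adjunctions between tensoring with `P` and with its dual. -/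
theorem nonempty_tensorLeft_adjunction {C : Type u} [Category.{v} C] [MonoidalCategory C]
    [RigidCategory C] {P : C} (e : Nonempty ((ᘁP : C) ≅ Pᘁ)) (c : QVar) :
    Nonempty (tensorLeft (c.obj P) ⊣ tensorLeft (c.swap.obj P)) := by
  obtain ⟨e⟩ := e
  cases c
  -- The right adjoint of tensoring by `P` is tensoring by `ᘁP`; only this colour needs the
  -- isomorphism with `Pᘁ`.
  · exact ⟨(tensorLeftAdjunction (ᘁP : C) P).ofNatIsoRight ((curriedTensor C).mapIso e)⟩
  · exact ⟨tensorLeftAdjunction P (Pᘁ)⟩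

/-! ### Quantum numbers in the Grothendieck ring -/

section QuantumIn

variable {C : Type u} [Category.{v} C] [Abelian C] [MonoidalCategory C] [MonoidalPreadditive C]
  [RigidCategory C]

theorem specialize_ι (P : C) (c : QVar) :
    specialize P (FreeAlgebra.ι ℤ c) = K0.mk (c.obj P) := by
  rw [specialize, FreeAlgebra.lift_ι_apply]
  cases c <;> rfl

theorem quantumIn_zero (P : C) (c : QVar) : quantumIn P 0 c = 0 := by
  rw [quantumIn, quantum_zero, map_zero]

theorem quantumIn_one (P : C) (c : QVar) : quantumIn P 1 c = 1 := by
  rw [quantumIn, quantum_one, map_one]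

theorem quantumIn_neg (P : C) (n : ℤ) (c : QVar) : quantumIn P (-n) c = -quantumIn P n c := by
  rw [quantumIn, quantum_neg, map_neg, quantumIn]

theorem mk_mul_quantumIn (P : C) (n : ℤ) (c : QVar) :
    K0.mk (c.obj P) * quantumIn P n c.swap = quantumIn P (n + 1) c + quantumIn P (n - 1) c := by
  simp only [quantumIn, ← specialize_ι, ← map_mul, ← map_add, quantum_recurse]

/-- If `[n]_c` vanishes, then so does the product of the variable `c` with `[n]` in the other
colour. -/
theorem mk_mul_quantumIn_eq_zero (P : C) {n : ℤ} (hn : 0 ≤ n) {c : QVar}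
    (h : quantumIn P n c = 0) : K0.mk (c.obj P) * quantumIn P n c.swap = 0 := by
  lift n to ℕ using hn
  change specialize P (quantumNat n c) = 0 at h
  change K0.mk (c.obj P) * specialize P (quantumNat n c.swap) = 0
  rw [← specialize_ι, ← map_mul, ← quantumNat_mul_ι, map_mul, h, zero_mul]

section Periodicity

variable {P : C} {m : ℤ}

/-- The sum of the two values obeys the two-step recursion in `j`. It vanishes at `j = 0`, and at `j
= 1` it is a multiple of `[m]` in the other colour, so both colours must vanish at `m`. -/
theorem quantumIn_add_eq_neg_sub (h : ∀ c, quantumIn P m c = 0) (j : ℤ) (c : QVar) :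
    quantumIn P (m + j) c = -quantumIn P (m - j) c := by
  have nat : ∀ (j : ℕ) (c : QVar), quantumIn P (m + j) c + quantumIn P (m - j) c = 0 := by
    intro j
    induction j using Nat.twoStepInduction with
    | zero => simp [h]
    | one => intro c; simp [← mk_mul_quantumIn, h]
    | more j h0 h1 =>
      intro c
      have h2 := congrArg (K0.mk (c.obj P) * ·) (h1 c.swap)
      have h3 := h0 c
      simp only [mul_add, mk_mul_quantumIn, mul_zero] at h2
      push_cast at h2 ⊢
      rw [show m + (j + 1 : ℤ) + 1 = m + (j + 2) by ring, show m + (j + 1 : ℤ) - 1 = m + j by ring,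
        show m - (j + 1 : ℤ) + 1 = m - j by ring, show m - (j + 1 : ℤ) - 1 = m - (j + 2) by ring]
        at h2
      have h4 := congrArg₂ (· - ·) h2 h3
      rw [sub_zero] at h4
      rw [← h4]
      abel
  rw [eq_neg_iff_add_eq_zero]
  obtain ⟨n, rfl | rfl⟩ := j.eq_nat_or_neg
  · exact nat n c
  · rw [← sub_eq_add_neg, sub_neg_eq_add, add_comm]
    exact nat n c

/-- Composing the antisymmetries about `m` and about `0` is translation by `2 * m`. -/
theorem quantumIn_add_two_mul (h : ∀ c, quantumIn P m c = 0) (j : ℤ) (c : QVar) :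
    quantumIn P (j + 2 * m) c = quantumIn P j c := by
  rw [show j + 2 * m = m + (j + m) by ring, quantumIn_add_eq_neg_sub h,
    show m - (j + m) = -j by ring, quantumIn_neg, neg_neg]

theorem quantumIn_add_even_mul (h : ∀ c, quantumIn P m c = 0) (j r : ℤ) (c : QVar) :
    quantumIn P (j + 2 * r * m) c = quantumIn P j c := by
  induction r using Int.induction_on with
  | zero => simp
  | succ r ih =>
    rw [show j + 2 * ((r : ℤ) + 1) * m = j + 2 * r * m + 2 * m by ring, quantumIn_add_two_mul h, ih]
  | pred r ih =>
    rw [← quantumIn_add_two_mul h, ← ih]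
    congr 1
    ring

theorem quantumIn_add_odd_mul (h : ∀ c, quantumIn P m c = 0) (j r : ℤ) (c : QVar) :
    quantumIn P (j + (2 * r + 1) * m) c = -quantumIn P (m - j) c := by
  rw [show j + (2 * r + 1) * m = m + j + 2 * r * m by ring, quantumIn_add_even_mul h,
    quantumIn_add_eq_neg_sub h]

/-- An even shift changes nothing; an odd one gives minus the value at `m - j`, which again lies
strictly between `0` and `m`. -/
theorem quantumIn_mem_signedPos (h : ∀ c, quantumIn P m c = 0)
    (hpos : ∀ j : ℤ, 0 < j → j < m → ∀ c, quantumIn P j c ∈ K0.pos C) {j : ℤ} (hj : 0 < j)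
    (hjm : j < m) (r : ℤ) (c : QVar) : quantumIn P (j + r * m) c ∈ K0.signedPos C r := by
  obtain ⟨s, rfl | rfl⟩ := r.even_or_odd'
  · refine ⟨_, hpos j hj hjm c, ?_⟩
    rw [quantumIn_add_even_mul h, zpow_mul]
    simp
  · refine ⟨_, hpos (m - j) (by omega) (by omega) c, ?_⟩
    rw [quantumIn_add_odd_mul h, zpow_add, zpow_mul]
    simp

theorem quantumIn_mul_eq_zero (h : ∀ c, quantumIn P m c = 0) (r : ℤ) (c : QVar) :
    quantumIn P (r * m) c = 0 := by
  obtain ⟨s, rfl | rfl⟩ := r.even_or_odd'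
  · simpa [quantumIn_zero] using quantumIn_add_even_mul h 0 s c
  · simpa [h] using quantumIn_add_odd_mul h 0 s c

end Periodicity

theorem K0.signedPos_trichotomy {r : ℤ} {x : K0 C} (hx : x ∈ K0.signedPos C r) :
    x ∈ K0.pos C ∨ -x ∈ K0.pos C := by
  obtain ⟨y, hy, rfl⟩ := hx
  rcases Int.units_eq_one_or ((-1) ^ r) with e | e <;> simp [e, hy]

theorem K0.ne_zero_of_mem_signedPos {r : ℤ} {x : K0 C} (hx : x ∈ K0.signedPos C r) : x ≠ 0 := by
  rintro rfl
  rcases K0.signedPos_trichotomy hx with h | h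
  · exact h.2 rfl
  · exact h.2 neg_zero

theorem quantumIn_eq_zero_iff {P : C} {m : ℤ} (hm : 0 < m) (h : ∀ c, quantumIn P m c = 0)
    (hpos : ∀ j : ℤ, 0 < j → j < m → ∀ c, quantumIn P j c ∈ K0.pos C) (j : ℤ) (c : QVar) :
    quantumIn P j c = 0 ↔ m ∣ j := by
  constructor
  · intro hj
    by_contra hd
    have h0 : 0 < j % m := lt_of_le_of_ne (Int.emod_nonneg _ hm.ne')
      fun e => hd (Int.dvd_of_emod_eq_zero e.symm)
    have := quantumIn_mem_signedPos h hpos h0 (Int.emod_lt_of_pos j hm) (j / m) c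
    rw [Int.emod_add_ediv_mul] at this
    exact K0.ne_zero_of_mem_signedPos this hj
  · rintro ⟨r, rfl⟩
    rw [mul_comm]
    exact quantumIn_mul_eq_zero h r c

theorem quantumIn_trichotomy {P : C} {m : ℤ} (hm : 0 < m) (h : ∀ c, quantumIn P m c = 0)
    (hpos : ∀ j : ℤ, 0 < j → j < m → ∀ c, quantumIn P j c ∈ K0.pos C) (j : ℤ) (c : QVar) :
    quantumIn P j c ∈ K0.pos C ∨ quantumIn P j c = 0 ∨ -quantumIn P j c ∈ K0.pos C := by
  by_cases hd : m ∣ j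
  · exact Or.inr (Or.inl ((quantumIn_eq_zero_iff hm h hpos j c).2 hd))
  · have h0 : 0 < j % m := lt_of_le_of_ne (Int.emod_nonneg _ hm.ne')
      fun e => hd (Int.dvd_of_emod_eq_zero e.symm)
    have := quantumIn_mem_signedPos h hpos h0 (Int.emod_lt_of_pos j hm) (j / m) c
    rw [Int.emod_add_ediv_mul] at this
    rcases K0.signedPos_trichotomy this with h' | h'
    · exact Or.inl h'
    · exact Or.inr (Or.inr h')

end QuantumIn

/-! ### Realising quantum numbers by objects -/

section Positivity

variable {C : Type u} [Category.{v} C] [Abelian C] [MonoidalCategory C] [MonoidalPreadditive C]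
  [RigidCategory C] {P : C}

/-- As long as the quantum numbers do not vanish, consecutive ones are classes of objects `X`, `Y`
connected by a morphism with only trivial idempotent endomorphisms. -/
theorem exists_hasTrivialIdempotents [Simple (𝟙_ C)] (hproj : ∀ X : C, Projective X)
    (e : Nonempty ((ᘁP : C) ≅ Pᘁ)) (n : ℕ) {c c' : QVar} (hc : c' = c.swap)
    (h : ∀ j : ℕ, 0 < j → j ≤ n → ∀ c, quantumIn P j c ≠ 0) :
    ∃ (X Y : C) (g : X ⟶ (tensorLeft (c'.obj P)).obj Y), HasTrivialIdempotents g ∧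
      K0.mk X = quantumIn P n c' ∧ K0.mk Y = quantumIn P (n + 1) c := by
  induction n generalizing c c' with
  | zero =>
    obtain ⟨Z, hZ⟩ := HasZeroObject.zero (C := C)
    refine ⟨Z, 𝟙_ C, 0, fun a b _ hb _ => ?_, ?_, ?_⟩
    · rcases idempotent_eq_zero_or_id hb with rfl | rfl
      · exact Or.inl ⟨hZ.eq_of_src _ _, rfl⟩
      · exact Or.inr ⟨hZ.eq_of_src _ _, rfl⟩
    · simp [quantumIn_zero, K0.mk_eq_zero hZ]
    · simp [quantumIn_one, K0.one_def]
  | succ n ih =>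
    have hc' : c = c'.swap := by rw [hc, QVar.swap_swap]
    obtain ⟨X, Y, g, hg, hX, hY⟩ := ih hc' fun j h0 hj => h j h0 (by omega)
    -- Nonvanishing is needed only for the old `Y`; the new cokernel may be zero. Thus the result
    -- still applies at the first vanishing quantum number.
    have hYne : ¬ IsZero Y := fun h0 =>
      h (n + 1) (by omega) le_rfl c' (by rw [Nat.cast_succ, ← hY, K0.mk_eq_zero h0])
    have : Mono g := hg.mono hYne hproj
    obtain ⟨adj⟩ := nonempty_tensorLeft_adjunction e c
    rw [← hc] at adj
    have hS : (ShortComplex.mk g (cokernel.π g) (cokernel.condition g)).ShortExact :=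
      { exact := ShortComplex.exact_cokernel g
        mono_f := ‹Mono g›
        epi_g := inferInstanceAs (Epi (cokernel.π g)) }
    refine ⟨Y, cokernel g, adj.homEquiv _ _ (cokernel.π g), hg.cokernel adj, by simpa using hY, ?_⟩
    -- Comparison with the recursion for `[c] * [n + 1]_{c'}` identifies the cokernel as `[n +
    -- 2]_c`, since `X` has class `[n]_c`.
    have h1 : K0.mk (c.obj P ⊗ Y) = K0.mk X + K0.mk (cokernel g) := K0.mk_shortExact hS
    have h2 := mk_mul_quantumIn P (n + 1) c
    rw [← hc, ← hY, K0.mk_mul_mk, h1, add_sub_cancel_right, hX, add_comm] at h2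
    simpa using add_right_cancel h2

/-- `[n]_c` is the class of an object if no smaller positive quantum number vanishes. -/
theorem quantumIn_mem_nonneg [Simple (𝟙_ C)] (hproj : ∀ X : C, Projective X)
    (e : Nonempty ((ᘁP : C) ≅ Pᘁ)) {n : ℤ} (hn : 0 < n) (c : QVar)
    (h : ∀ j : ℤ, 0 < j → j < n → ∀ c, quantumIn P j c ≠ 0) : quantumIn P n c ∈ K0.nonneg C := by
  obtain ⟨m, rfl⟩ := Int.eq_succ_of_zero_lt hn
  obtain ⟨_, Y, _, -, -, hY⟩ := exists_hasTrivialIdempotents hproj e m (c := c) rfl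
    fun j h0 hj => h j (by omega) (by omega)
  exact ⟨Y, by simpa using hY⟩

end Positivity

/-! ### Simultaneous vanishing and the main theorem -/

/-- At the first vanishing quantum number both colours vanish. -/
theorem quantumIn_eq_zero_of_swap (k : Type w) [Field k] {C : Type u} [Category.{v} C] [Abelian C]
    [Linear k C] [MonoidalCategory C] [MonoidalPreadditive C] [RigidCategory C]
    [∀ X Y : C, Module.Finite k (X ⟶ Y)] [Simple (𝟙_ C)] (hproj : ∀ X : C, Projective X) {P : C}
    {n : ℤ} (hn : 0 < n) {c : QVar} (hc : quantumIn P n c = 0)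
    (hneg : quantumIn P n c.swap ∈ K0.nonneg C)
    (hlt : ∀ j : ℤ, 0 < j → j < n → ∀ c, quantumIn P j c ≠ 0) : quantumIn P n c.swap = 0 := by
  -- The factor `P` can be cancelled only if it is nonzero. If it is zero, `[2]` vanishes in both
  -- colours and minimality forces `n ≤ 2`.
  by_cases hP : IsZero P
  · have hobj : ∀ c : QVar, quantumIn P 2 c = 0 := fun c => by
      have h2 := mk_mul_quantumIn P 1 c
      have hz : K0.mk (c.obj P) = 0 := K0.mk_eq_zero (by
        cases c
        · exact hP
        · exact (isZero_iff_of_exactPairing P (Pᘁ)).1 hP)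
      simpa [hz, quantumIn_zero] using h2.symm
    obtain rfl | rfl | h3 : n = 1 ∨ n = 2 ∨ 2 < n := by omega
    · rw [quantumIn_one] at hc ⊢
      exact hc
    · exact hobj _
    · exact absurd (hobj c) (hlt 2 (by omega) h3 c)
  · obtain ⟨X, hX⟩ := hneg
    have h0 := mk_mul_quantumIn_eq_zero P hn.le hc
    rw [← hX, K0.mk_mul_mk] at h0
    have := hproj (c.obj P ⊗ X)
    have hobj : ¬ IsZero (c.obj P) := by
      cases c
      · exact hP
      · exact fun h => hP ((isZero_iff_of_exactPairing P (Pᘁ)).2 h)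
    rw [← hX, K0.mk_eq_zero (isZero_of_isZero_tensor hobj (K0.isZero_of_mk_eq_zero k h0))]

theorem mainTheorem7 {k : Type w} [Field k] [IsAlgClosed k]
    {C : Type u} [Category.{v} C] [Abelian C] [Linear k C] [MonoidalCategory C]
    [MonoidalPreadditive C] [MonoidalLinear k C] [RigidCategory C] [IsFusionCategory k C]
    (P : C) :
    ((∃ n : ℤ, n ≠ 0 ∧ (quantumIn P n .d = 0 ∨ quantumIn P n .d' = 0)) →
      ∃ m : ℤ,
        IsLeast {n : ℤ | 0 < n ∧ (quantumIn P n .d = 0 ∨ quantumIn P n .d' = 0)} m ∧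
        (∀ j : ℤ, (quantumIn P j .d = 0 ↔ m ∣ j) ∧ (quantumIn P j .d' = 0 ↔ m ∣ j)) ∧
        (∀ j : ℤ, 0 < j → j < m → ∀ c : ℤ,
          quantumIn P (j + c * m) .d ∈ K0.signedPos C c ∧
          quantumIn P (j + c * m) .d' ∈ K0.signedPos C c)) ∧
    ((∀ n : ℤ, n ≠ 0 → quantumIn P n .d ≠ 0 ∧ quantumIn P n .d' ≠ 0) →
      ∀ n : ℤ, 1 ≤ n → quantumIn P n .d ∈ K0.pos C ∧ quantumIn P n .d' ∈ K0.pos C) ∧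
    (∀ n : ℤ,
      (quantumIn P n .d ∈ K0.pos C ∨ quantumIn P n .d = 0 ∨ -quantumIn P n .d ∈ K0.pos C) ∧
      (quantumIn P n .d' ∈ K0.pos C ∨ quantumIn P n .d' = 0 ∨ -quantumIn P n .d' ∈ K0.pos C)) := by
  have hss := IsFusionCategory.semisimple k (C := C)
  have := IsFusionCategory.finite_hom (k := k) (C := C)
  have := IsFusionCategory.simple_unit k (C := C)
  have hproj := projective_of_semisimple hss
  have e := nonempty_leftDual_iso_rightDual k hss P
  have both : ∀ {p : QVar → Prop}, (∀ c, p c) ↔ p .d ∧ p .d' := fun {p} =>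
    ⟨fun h => ⟨h _, h _⟩, fun h c => by cases c; exacts [h.1, h.2]⟩
  have vanishing : (∃ n : ℤ, n ≠ 0 ∧ (quantumIn P n .d = 0 ∨ quantumIn P n .d' = 0)) →
      ∃ m : ℤ, IsLeast {n : ℤ | 0 < n ∧ (quantumIn P n .d = 0 ∨ quantumIn P n .d' = 0)} m ∧
        (∀ c, quantumIn P m c = 0) ∧
        ∀ j : ℤ, 0 < j → j < m → ∀ c, quantumIn P j c ∈ K0.pos C := by
    rintro ⟨n, hn, hn0⟩
    have hex : ∃ n : ℕ, 0 < n ∧ (quantumIn P n .d = 0 ∨ quantumIn P n .d' = 0) := by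
      refine ⟨n.natAbs, Int.natAbs_pos.2 hn, ?_⟩
      rcases n.natAbs_eq with h | h <;> rw [h] at hn0
      · exact hn0
      · simpa only [quantumIn_neg, neg_eq_zero] using hn0
    classical
    have hlt : ∀ j : ℤ, 0 < j → j < (Nat.find hex : ℤ) → ∀ c, quantumIn P j c ≠ 0 := by
      intro j h0 hj
      lift j to ℕ using h0.le
      have := Nat.find_min hex (m := j) (by omega)
      rw [not_and_or, not_or] at this
      exact both.2 (this.resolve_left (by omega))
    have hpos : (0 : ℤ) < Nat.find hex := by exact_mod_cast (Nat.find_spec hex).1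
    -- At the minimum itself both colours are still classes of objects, so the cancellation in
    -- `quantumIn_eq_zero_of_swap` applies to whichever colour is not yet known to vanish.
    have hneg := fun c => quantumIn_mem_nonneg hproj e hpos c hlt
    refine ⟨Nat.find hex, ⟨⟨hpos, (Nat.find_spec hex).2⟩, fun j hj => ?_⟩, both.2 ?_,
      fun j h0 hj c => ⟨quantumIn_mem_nonneg hproj e h0 c fun i hi hij => hlt i hi (hij.trans hj),
        hlt j h0 hj c⟩⟩
    · by_contra! hjm
      obtain ⟨h1, h2⟩ := both.1 (hlt j hj.1 hjm)
      exact hj.2.elim h1 h2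
    · rcases (Nat.find_spec hex).2 with h | h
      · exact ⟨h, quantumIn_eq_zero_of_swap k hproj hpos h (hneg _) hlt⟩
      · exact ⟨quantumIn_eq_zero_of_swap k hproj hpos h (hneg _) hlt, h⟩
  have nonvanishing : (∀ n : ℤ, n ≠ 0 → quantumIn P n .d ≠ 0 ∧ quantumIn P n .d' ≠ 0) →
      ∀ n : ℤ, 1 ≤ n → ∀ c, quantumIn P n c ∈ K0.pos C := fun h n hn c =>
    ⟨quantumIn_mem_nonneg hproj e hn c fun j h0 _ => both.2 (h j h0.ne'),
      (both (p := fun c => quantumIn P n c ≠ 0)).2 (h n (by omega)) c⟩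
  refine ⟨fun h => ?_, fun h n hn => both.1 (nonvanishing h n hn), fun n => ?_⟩
  · obtain ⟨m, hm, h0, hpos⟩ := vanishing h
    exact ⟨m, hm, fun j => both.1 (quantumIn_eq_zero_iff hm.1.1 h0 hpos j), fun j hj hjm r =>
      both.1 (quantumIn_mem_signedPos h0 hpos hj hjm r)⟩
  · suffices h : ∀ c, quantumIn P n c ∈ K0.pos C ∨ quantumIn P n c = 0 ∨
        -quantumIn P n c ∈ K0.pos C from ⟨h _, h _⟩
    intro c
    by_cases h : ∃ n : ℤ, n ≠ 0 ∧ (quantumIn P n .d = 0 ∨ quantumIn P n .d' = 0)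
    · obtain ⟨m, hm, h0, hpos⟩ := vanishing h
      exact quantumIn_trichotomy hm.1.1 h0 hpos n c
    · push Not at h
      obtain hn | rfl | hn := lt_trichotomy n 0
      · refine Or.inr (Or.inr ?_)
        rw [← quantumIn_neg]
        exact nonvanishing h (-n) (by omega) c
      · exact Or.inr (Or.inl (quantumIn_zero P c))
      · exact Or.inl (nonvanishing h n hn c)
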